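/- All graphs are finite and simple. A \emph{double subdivision} of a graph deletes an edge $uv$, adds two new vertices and joins both of them to $u$ and to $v$. A \emph{generalised triangle} is a graph isomorphic to $K_3$ or obtained from $K_3$ by a finite sequence of double subdivisions; let $\mathcal{K}$ be the class of generalised triangles and $\mathcal{H}$ the class of graphs that have a Hamiltonian path. A \emph{2-cut} of $G$ is a set $\{x,y\}$ of two vertices whose removal increases the number of components. For a component $C$ of $G-\{x,y\}$, the induced subgraph $G[V(C)\cup\{x,y\}]$ is an $\{x,y\}$-\emph{bridge} of $G$; it is \emph{trivial} if it has exactly three vertices. Let $\mathcal{K}_1$ be the class of those $G\in\mathcal{K}$ such that, for every 2-cut $\{x,y\}$ of $G$ and every $\{x,y\}$-bridge $B$, at least one of $x,y$ has degree $1$ in $B$. Let $\mathcal{K}_2$ be the class of those $G\in\mathcal{K}$ such that, for every 2-cut $\{x,y\}$ of $G$, at least one $\{x,y\}$-bridge is trivial. A \emph{Whitney 2-switch} of $G$ chooses a 2-cut $\{x,y\}$ and a component $C$ of $G-\{x,y\}$, and replaces the edges between $C$ and $\{x,y\}$ so that each $z\in V(C)$ becomes adjacent to $x$ (respectively $y$)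 if and only if it was adjacent to $y$ (respectively $x$) in $G$, all other edges being unchanged. Let $P(G,t)$ be the chromatic polynomial of $G$. \textbf{Lemma.} Let $G\in\mathcal{K}_1\cap\mathcal{K}_2$. Then there is a graph $H\in\mathcal{H}\cap\mathcal{K}$ (a generalised triangle with a Hamiltonian path) that is obtained from $G$ by a finite, possibly empty, sequence of Whitney 2-switches, and $P(G,t)=P(H,t)$ for this $H$. In particular, $P(G,t)$ is the chromatic polynomial of some graph in $\mathcal{H}\cap\mathcal{K}$. -/

import Mathlib

open Polynomial

universe u

namespace SimpleGraph

section ChromaticPolynomial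

variable {V : Type u}

/-- A proper colouring with `n` colours is the same as a partition of the vertex set into
independent classes together with an injective labelling of the classes by colours. -/
def coloringEquiv (G : SimpleGraph V) (n : ℕ) :
    G.Coloring (Fin n) ≃
      Σ s : {s : Setoid V // ∀ a b, G.Adj a b → ¬ s a b}, (Quotient s.1 ↪ Fin n) where
  toFun c := ⟨⟨Setoid.ker c, fun _ _ hab h => c.valid hab h⟩,
    ⟨Quotient.lift c (fun _ _ h => h), by
      intro p q
      induction p using Quotient.inductionOn
      induction q using Quotient.inductionOn
      exact fun h => Quotient.sound h⟩⟩
  invFun p := Coloring.mk (fun a => p.2 (Quotient.mk p.1.1 a)) (by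
    intro a b hab h
    exact p.1.2 a b hab (Quotient.exact (p.2.injective h)))
  left_inv c := by ext a; rfl
  right_inv := by
    rintro ⟨⟨s, hs⟩, f⟩
    have key : Setoid.ker (fun a => f (Quotient.mk s a)) = s := by
      ext a b
      rw [Setoid.ker_def]
      exact ⟨fun h => Quotient.exact (f.injective h), fun h => congrArg f (Quotient.sound h)⟩
    refine Sigma.ext (Subtype.ext key) ?_
    have aux : ∀ (t : Setoid V) (h : t = s) (g : Quotient t ↪ Fin n),
        (∀ a, g (Quotient.mk t a) = f (Quotient.mk s a)) → HEq g f := by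
      rintro t rfl g hg
      refine heq_of_eq (DFunLike.ext _ _ fun q => ?_)
      induction q using Quotient.inductionOn
      exact hg _
    exact aux _ key _ fun a => rfl

/-- Among integer polynomials there is exactly one whose value at every natural number `n`
is the number of proper colourings of `G` with `n` colours. -/
theorem existsUnique_chromaticPolynomial [Finite V] (G : SimpleGraph V) :
    ∃! P : ℤ[X], ∀ n : ℕ, P.eval (n : ℤ) = (Nat.card (G.Coloring (Fin n)) : ℤ) := by
  classical
  have : Fintype V := Fintype.ofFinite V
  have : Finite (Setoid V) :=
    Finite.of_injective (fun s : Setoid V => (s.r : V → V → Prop)) fun s t h =>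
      Setoid.ext fun a b => iff_of_eq (congrFun (congrFun h a) b)
  have : Fintype {s : Setoid V // ∀ a b, G.Adj a b → ¬ s a b} := Fintype.ofFinite _
  refine ⟨∑ s : {s : Setoid V // ∀ a b, G.Adj a b → ¬ s a b},
    descPochhammer ℤ (Fintype.card (Quotient s.1)), fun n => ?_, fun Q hQ => ?_⟩
  · rw [Nat.card_congr (coloringEquiv G n), Nat.card_sigma, eval_finsetSum, Nat.cast_sum]
    refine Finset.sum_congr rfl fun s _ => ?_
    rw [descPochhammer_eval_eq_descFactorial, Nat.card_eq_fintype_card,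
      Fintype.card_embedding_eq, Fintype.card_fin]
  · refine Polynomial.eq_of_infinite_eval_eq _ _
      ((Set.infinite_range_of_injective (Nat.cast_injective (R := ℤ))).mono ?_)
    rintro _ ⟨n, rfl⟩
    rw [Set.mem_ofPred_eq, hQ n, Nat.card_congr (coloringEquiv G n), Nat.card_sigma,
      eval_finsetSum, Nat.cast_sum]
    refine Finset.sum_congr rfl fun s _ => ?_
    rw [descPochhammer_eval_eq_descFactorial, Nat.card_eq_fintype_card,
      Fintype.card_embedding_eq, Fintype.card_fin]

/-- The chromatic polynomial `P(G, t)`: the polynomial whose value at every natural number `n`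
is the number of proper colourings of `G` with `n` colours. -/
noncomputable def chromaticPolynomial [Finite V] (G : SimpleGraph V) : ℤ[X] :=
  (existsUnique_chromaticPolynomial G).choose

theorem chromaticPolynomial_eval [Finite V] (G : SimpleGraph V) (n : ℕ) :
    G.chromaticPolynomial.eval (n : ℤ) = (Nat.card (G.Coloring (Fin n)) : ℤ) :=
  (existsUnique_chromaticPolynomial G).choose_spec.1 n

end ChromaticPolynomial

/-- Double subdivision of the edge `uv`: delete `uv`, add two new vertices (the right summand)
and join both of them to `u` and to `v`. -/
def doubleSubdivision {V : Type u} (G : SimpleGraph V) (u v : V) : SimpleGraph (V ⊕ Fin 2) :=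
  (G.deleteEdges {s(u, v)} ⊕g (⊥ : SimpleGraph (Fin 2))) ⊔
    fromRel fun a b => (a = Sum.inl u ∨ a = Sum.inl v) ∧ ∃ i : Fin 2, b = Sum.inr i

/-- Generalised triangles: the graphs obtained, up to isomorphism, from `K₃` by a (possibly
empty) sequence of double subdivisions of edges. -/
inductive IsGeneralisedTriangle : {V : Type u} → SimpleGraph V → Prop
  | triangle {V : Type u} {G : SimpleGraph V} (e : G ≃g completeGraph (Fin 3)) :
      IsGeneralisedTriangle G
  | step {V W : Type u} {G : SimpleGraph V} {H : SimpleGraph W} {u v : V}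
      (hG : IsGeneralisedTriangle G) (huv : G.Adj u v) (e : H ≃g G.doubleSubdivision u v) :
      IsGeneralisedTriangle H

section Cuts

variable {V : Type u} (G : SimpleGraph V)

/-- A cut-set: a set of vertices whose removal increases the number of components. -/
def IsCutSet (S : Set V) : Prop :=
  Nat.card G.ConnectedComponent < Nat.card (G.induce Sᶜ).ConnectedComponent

/-- `{x, y}` is a 2-cut. -/
def IsTwoCut (x y : V) : Prop := x ≠ y ∧ G.IsCutSet {x, y}

/-- The components of `G - {x, y}`. -/
abbrev CutComponent (x y : V) : Type u := (G.induce ({x, y}ᶜ : Set V)).ConnectedComponent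

variable {G}

/-- The vertex set, in `V`, of a component of `G - {x, y}`. -/
def CutComponent.verts {x y : V} (C : G.CutComponent x y) : Set V := Subtype.val '' C.supp

/-- The `{x, y}`-bridge `G[V(C) ∪ {x, y}]` of the component `C` of `G - {x, y}`. -/
def CutComponent.bridge {x y : V} (C : G.CutComponent x y) : G.Subgraph :=
  (⊤ : G.Subgraph).induce (CutComponent.verts C ∪ {x, y})

variable (G)

/-- Property `P₁` of `{x, y}`: in every `{x, y}`-bridge, `x` or `y` has degree 1. -/
def PropertyP₁ (x y : V) : Prop :=
  ∀ C : G.CutComponent x y,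
    ((CutComponent.bridge C).neighborSet x).ncard = 1 ∨
      ((CutComponent.bridge C).neighborSet y).ncard = 1

/-- Property `P₂` of `{x, y}`: some `{x, y}`-bridge is trivial, i.e. has exactly 3 vertices. -/
def PropertyP₂ (x y : V) : Prop :=
  ∃ C : G.CutComponent x y, (CutComponent.bridge C).verts.ncard = 3

/-- The class `K₁`: generalised triangles all of whose 2-cuts have property `P₁`. -/
def MemK₁ : Prop := G.IsGeneralisedTriangle ∧ ∀ x y, G.IsTwoCut x y → G.PropertyP₁ x y

/-- The class `K₂`: generalised triangles all of whose 2-cuts have property `P₂`. -/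
def MemK₂ : Prop := G.IsGeneralisedTriangle ∧ ∀ x y, G.IsTwoCut x y → G.PropertyP₂ x y

variable {G}

/-- The graph obtained from `G` by exchanging the roles of `x` and `y` for the component `C` of
`G - {x, y}`: edges inside `C` and edges of `G - C` are kept, and `z ∈ C` is joined to `x`
(respectively `y`) iff it was joined to `y` (respectively `x`) in `G`. -/
def CutComponent.switch {x y : V} (C : G.CutComponent x y) : SimpleGraph V :=
  fromRel fun a b =>
    (G.Adj a b ∧ (a ∈ CutComponent.verts C ↔ b ∈ CutComponent.verts C)) ∨
    (a ∈ CutComponent.verts C ∧ b = x ∧ G.Adj a y) ∨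
    (a ∈ CutComponent.verts C ∧ b = y ∧ G.Adj a x)

/-- `H` arises from `G` by one Whitney 2-switch. -/
def IsWhitneySwitch (G H : SimpleGraph V) : Prop :=
  ∃ x y : V, G.IsTwoCut x y ∧ ∃ C : G.CutComponent x y, H = CutComponent.switch C

open Classical in
/-- `G` has a Hamiltonian path. -/
def HasHamiltonianPath (G : SimpleGraph V) : Prop :=
  ∃ (a b : V) (p : G.Walk a b), p.IsHamiltonian

end Cuts

end SimpleGraph

namespace SimpleGraph

variable {V W : Type u}

/-! The conditions on 2-cuts force a linear structure. Unless `G` is a triangle, it is a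
`caterpillar`: a chain of pairs of non-adjacent vertices, consecutive pairs sharing a vertex, where
each pair has a private common neighbour of degree two and each end of the chain carries one further
such neighbour. A `Branch` records one half of the chain as seen from a pair; its Booleans say which
vertex of the current pair survives into the next.

This structure is proved by induction on the double subdivisions
(`IsGeneralisedTriangle.exists_isCaterpillar`). The conditions enter only through pairs that leave
exactly three components, and in that form (`HasThinSplits`) they descend from a double subdivision
to the original graph. By `exists_root`, any edge of a caterpillar can be viewed from a root where
it is of one of two kinds. Subdividing one kind breaks the degree condition. Subdividing the other
breaks the trivial-bridge condition unless one branch at the root is a leaf, and then the chain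
merely grows at an end.

A Whitney 2-switch at a pair exchanges the poles of one branch, so it negates a single Boolean.
Working along the chain from one end makes every Boolean `true`. In such a zigzag the vertices of
degree two and the chain vertices alternate along a Hamiltonian path. Every caterpillar is a
generalised triangle, since its end nodes can be removed by undoing double subdivisions. Finally, a
switch preserves the number of colourings: exchange the colours of `x` and `y` on the switched
component. -/

theorem map_sup_embedding (f : V ↪ W) (G H : SimpleGraph V) :
    (G ⊔ H).map f = G.map f ⊔ H.map f := by
  ext a b
  simp only [map_adj, sup_adj]
  grind

theorem map_edge_embedding (f : V ↪ W) (a b : V) :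
    (edge a b).map f = edge (f a) (f b) := by
  ext c d
  simp only [map_adj, edge_adj]
  constructor
  · rintro ⟨u, v, ⟨h | h, hne⟩, rfl, rfl⟩
    · obtain ⟨rfl, rfl⟩ := h
      exact ⟨Or.inl ⟨rfl, rfl⟩, f.injective.ne hne⟩
    · obtain ⟨rfl, rfl⟩ := h
      exact ⟨Or.inr ⟨rfl, rfl⟩, f.injective.ne hne⟩
  · rintro ⟨⟨rfl, rfl⟩ | ⟨rfl, rfl⟩, hne⟩
    · exact ⟨a, b, ⟨Or.inl ⟨rfl, rfl⟩, fun h => hne (congrArg f h)⟩, rfl, rfl⟩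
    · exact ⟨b, a, ⟨Or.inr ⟨rfl, rfl⟩, fun h => hne (congrArg f h)⟩, rfl, rfl⟩

/-! ### Branches and caterpillars -/

/-- A branch of a caterpillar of triangles, to be attached to an ordered pair `(p, q)` of poles.
A leaf is a vertex joined to both poles; a node has a spine vertex `z`, a vertex `n` of degree two
and a further branch, and its Boolean tells which pole is kept as a pole of the further branch. -/
inductive Branch (V : Type u) : Type u
  | leaf (e : V) : Branch V
  | node (b : Bool) (z n : V) (t : Branch V) : Branch V

namespace Branch

/-- The vertices of a branch, without the poles. -/
def verts : Branch V → List V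
  | leaf e => [e]
  | node _ z n t => z :: n :: t.verts

/-- The graph of a branch attached to the poles `(p, q)`. -/
def graph : Branch V → V → V → SimpleGraph V
  | leaf e, p, q => edge p e ⊔ edge q e
  | node true z n t, p, q => edge p z ⊔ edge q n ⊔ edge n z ⊔ t.graph q z
  | node false z n t, p, q => edge q z ⊔ edge p n ⊔ edge n z ⊔ t.graph p z

/-- The branch with its first Boolean negated: attaching it amounts to exchanging the poles. -/
def flip : Branch V → Branch V
  | leaf e => leaf e
  | node b z n t => node (!b) z n t

/-- Relabelling of the vertices of a branch. -/
def map (f : V → W) : Branch V → Branch W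
  | leaf e => leaf (f e)
  | node b z n t => node b (f z) (f n) (t.map f)

/-- All Booleans of the branch are `true`. -/
def IsZigzag : Branch V → Prop
  | leaf _ => True
  | node b _ _ t => b = true ∧ t.IsZigzag

@[simp] theorem verts_flip (t : Branch V) : t.flip.verts = t.verts := by
  cases t <;> rfl

@[simp] theorem graph_flip (t : Branch V) (p q : V) : t.flip.graph p q = t.graph q p := by
  rcases t with e | ⟨_ | _, z, n, t⟩
  · simp [flip, graph, sup_comm]
  all_goals simp [flip, graph]

@[simp] theorem verts_map (f : V → W) (t : Branch V) : (t.map f).verts = t.verts.map f := by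
  induction t with
  | leaf e => rfl
  | node b z n t ih => simp [map, verts, ih]

theorem map_eq_self {f : V → V} (t : Branch V) (h : ∀ v ∈ t.verts, f v = v) : t.map f = t := by
  induction t with
  | leaf e => simpa [map, verts] using h
  | node b z n t ih =>
    simp only [verts, List.mem_cons, forall_eq_or_imp] at h
    simp [map, h.1, h.2.1, ih h.2.2]

theorem graph_map (f : V ↪ W) (t : Branch V) (p q : V) :
    (t.graph p q).map f = (t.map f).graph (f p) (f q) := by
  induction t generalizing p q with
  | leaf e => simp [graph, map, map_sup_embedding, map_edge_embedding]
  | node b z n t ih =>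
    cases b <;> simp [graph, map, map_sup_embedding, map_edge_embedding, ih]

theorem mem_of_adj {t : Branch V} {p q a b : V} (h : (t.graph p q).Adj a b) :
    (a ∈ t.verts ∨ b ∈ t.verts) ∧ (a ∈ t.verts ∨ a = p ∨ a = q) ∧
      (b ∈ t.verts ∨ b = p ∨ b = q) := by
  induction t generalizing p q with
  | leaf e => simp only [graph, sup_adj, edge_adj, verts, List.mem_singleton] at h ⊢; grind
  | node c z n t ih =>
    cases c <;> simp only [graph, sup_adj, edge_adj, verts, List.mem_cons] at h ⊢ <;> grind

theorem exists_adj {t : Branch V} {p q : V} (hp : p ∉ t.verts) (hq : q ∉ t.verts)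
    (ht : t.verts.Nodup) :
    (∃ v ∈ t.verts, (t.graph p q).Adj p v) ∧ (∃ v ∈ t.verts, (t.graph p q).Adj q v) := by
  rcases t with e | ⟨_ | _, z, n, t⟩ <;>
    simp only [graph, sup_adj, edge_adj, verts, List.mem_cons, List.not_mem_nil] at * <;> grind

/-- A branch without its poles is connected. -/
theorem verts_subset_of_closed {t : Branch V} {p q : V} (hp : p ∉ t.verts) (hq : q ∉ t.verts)
    (ht : t.verts.Nodup) {T : Set V}
    (hT : ∀ a ∈ T, ∀ b ∈ t.verts, (t.graph p q).Adj a b → b ∈ T)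
    {w : V} (hw : w ∈ t.verts) (hwT : w ∈ T) : ∀ v ∈ t.verts, v ∈ T := by
  induction t generalizing p q w with
  | leaf e =>
    simp only [verts, List.mem_singleton] at hw ⊢
    grind
  | node c z n t ih =>
    obtain ⟨r, hr, hG, hzn⟩ : ∃ r, r ∉ t.verts ∧
        (node c z n t).graph p q ≥ t.graph r z ∧ ((node c z n t).graph p q).Adj n z := by
      simp only [verts, List.mem_cons, List.nodup_cons] at *
      cases c
      · exact ⟨p, by grind, by simp only [graph]; exact le_sup_right,
          by simp only [graph, sup_adj, edge_adj]; grind⟩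
      · exact ⟨q, by grind, by simp only [graph]; exact le_sup_right,
          by simp only [graph, sup_adj, edge_adj]; grind⟩
    simp only [verts, List.mem_cons, List.nodup_cons] at *
    have hzt : z ∉ t.verts := by grind
    have hnt : t.verts.Nodup := by grind
    obtain ⟨-, y, hy, hzy⟩ := exists_adj hr hzt hnt
    have hzy' := hG hzy
    have key : ∀ w ∈ t.verts, w ∈ T → ∀ v ∈ t.verts, v ∈ T := fun w hw hwT =>
      ih hr hzt hnt (fun a ha b hb hab => hT a ha b (Or.inr (Or.inr hb)) (hG hab)) hw hwT
    have hz : z ∈ T := by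
      rcases hw with rfl | rfl | hw
      · exact hwT
      · exact hT _ hwT _ (Or.inl rfl) hzn
      · exact hT y (key w hw hwT y hy) z (Or.inl rfl) hzy'.symm
    rintro v (rfl | rfl | hv)
    · exact hz
    · exact hT z hz _ (Or.inr (Or.inl rfl)) hzn.symm
    · exact key y hy (hT z hz y (Or.inr (Or.inr hy)) hzy') v hv

end Branch

/-- The caterpillar of triangles with root pair `{x, y}`, a vertex `m` joined to both, and two
branches attached to `(x, y)` and `(y, x)`. -/
def caterpillar (x y m : V) (s t : Branch V) : SimpleGraph V :=
  edge m x ⊔ edge m y ⊔ s.graph x y ⊔ t.graph y x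

/-- The vertices of a caterpillar. -/
def caterpillarVerts (x y m : V) (s t : Branch V) : List V := x :: y :: m :: (s.verts ++ t.verts)

theorem caterpillar_swap (x y m : V) (s t : Branch V) :
    caterpillar x y m s t = caterpillar y x m t s := by
  simp only [caterpillar]; ac_rfl

/-- Naming the root pair in the other order exchanges the poles of both branches. This lets a
leading `false` on one chosen branch be read as `true`. -/
theorem caterpillar_flip (x y m : V) (s t : Branch V) :
    caterpillar x y m s t = caterpillar y x m s.flip t.flip := by
  simp only [caterpillar, Branch.graph_flip]; ac_rfl

/-- The same edges seen from the next pair `{y, z}` of the chain: the old root becomes the first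
node of the opposite branch. Its Boolean is `true` because the shared vertex `y` is the second pole
of `(z, y)`. -/
theorem caterpillar_reroot (x y m z n : V) (s t : Branch V) :
    caterpillar x y m (.node true z n s) t = caterpillar y z n s (.node true x m t) := by
  simp only [caterpillar, Branch.graph, edge_comm z x, edge_comm y m, edge_comm y n]; ac_rfl

/-- The vertices `m` and `e` are twins, both joined exactly to `x` and `y`. -/
theorem caterpillar_leaf_swap (x y m e : V) (t : Branch V) :
    caterpillar x y m (.leaf e) t = caterpillar x y e (.leaf m) t := by
  simp only [caterpillar, Branch.graph, edge_comm x, edge_comm y]; ac_rfl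

theorem caterpillar_map (f : V ↪ W) (x y m : V) (s t : Branch V) :
    (caterpillar x y m s t).map f = caterpillar (f x) (f y) (f m) (s.map f) (t.map f) := by
  simp only [caterpillar, map_sup_embedding, map_edge_embedding, Branch.graph_map]

/-- `G` is the caterpillar with the given data, which list each vertex exactly once. -/
structure IsCaterpillar (G : SimpleGraph V) (x y m : V) (s t : Branch V) : Prop where
  eq : G = caterpillar x y m s t
  nodup : (caterpillarVerts x y m s t).Nodup
  mem : ∀ v, v ∈ caterpillarVerts x y m s t

namespace IsCaterpillar

variable {G : SimpleGraph V} {x y m z n e : V} {s t : Branch V}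

theorem of_perm {x' y' m' : V} {s' t' : Branch V} (h : IsCaterpillar G x y m s t)
    (he : caterpillar x y m s t = caterpillar x' y' m' s' t')
    (hp : (caterpillarVerts x y m s t).Perm (caterpillarVerts x' y' m' s' t')) :
    IsCaterpillar G x' y' m' s' t' :=
  ⟨h.eq.trans he, hp.nodup_iff.1 h.nodup, fun v => hp.mem_iff.1 (h.mem v)⟩

theorem swap (h : IsCaterpillar G x y m s t) : IsCaterpillar G y x m t s := by
  refine h.of_perm (caterpillar_swap ..) ?_
  classical
  simp only [caterpillarVerts, List.perm_iff_count, List.count_cons, List.count_append]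
  intro a; omega

theorem flip (h : IsCaterpillar G x y m s t) : IsCaterpillar G y x m s.flip t.flip := by
  refine h.of_perm (caterpillar_flip ..) ?_
  classical
  simp only [caterpillarVerts, List.perm_iff_count, List.count_cons, List.count_append,
    Branch.verts_flip]
  intro a; omega

theorem reroot (h : IsCaterpillar G x y m (.node true z n s) t) :
    IsCaterpillar G y z n s (.node true x m t) := by
  refine h.of_perm (caterpillar_reroot ..) ?_
  classical
  simp only [caterpillarVerts, List.perm_iff_count, List.count_cons, List.count_append,
    Branch.verts]
  intro a; omega

theorem leaf_swap (h : IsCaterpillar G x y m (.leaf e) t) :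
    IsCaterpillar G x y e (.leaf m) t := by
  refine h.of_perm (caterpillar_leaf_swap ..) ?_
  classical
  simp only [caterpillarVerts, List.perm_iff_count, List.count_cons, List.count_append,
    Branch.verts]
  intro a; omega

theorem map {G' : SimpleGraph W} (h : IsCaterpillar G x y m s t) (f : G ≃g G') :
    IsCaterpillar G' (f x) (f y) (f m) (s.map f) (t.map f) := by
  have hv : caterpillarVerts (f x) (f y) (f m) (s.map f) (t.map f) =
      (caterpillarVerts x y m s t).map f := by simp [caterpillarVerts]
  refine ⟨?_, hv ▸ h.nodup.map f.injective, fun v => ?_⟩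
  · have := caterpillar_map f.toEquiv.toEmbedding x y m s t
    rw [← h.eq] at this
    refine Eq.trans ?_ this
    ext a b
    rw [map_adj]
    constructor
    · intro hab
      exact ⟨f.symm a, f.symm b, f.symm.map_adj_iff.2 hab, f.apply_symm_apply a,
        f.apply_symm_apply b⟩
    · rintro ⟨a, b, hab, rfl, rfl⟩
      exact f.map_adj_iff.2 hab
  · rw [hv]
    exact List.mem_map.2 ⟨f.symm v, h.mem _, f.apply_symm_apply v⟩

/-- Every edge of a caterpillar is, for a suitable choice of the root, either an edge at the
degree-two vertex of the root, or the edge of the root triangle that is in no other 2-cut. -/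
theorem exists_root (h : IsCaterpillar G x y m s t) {u v : V} (huv : G.Adj u v) :
    ∃ x y m s t, IsCaterpillar G x y m s t ∧
      (s(u, v) = s(y, m) ∨ ∃ z n s', s = .node true z n s' ∧ s(u, v) = s(x, z)) := by
  -- An edge deep inside a branch is reached by rerooting one pair at a time; a leading `false` is
  -- first removed by reversing the root pair.
  have branch : ∀ (s : Branch V) (x y m : V) (t : Branch V), IsCaterpillar G x y m s t →
      (s.graph x y).Adj u v → ∃ x y m s t, IsCaterpillar G x y m s t ∧
      (s(u, v) = s(y, m) ∨ ∃ z n s', s = .node true z n s' ∧ s(u, v) = s(x, z)) := by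
    intro s
    induction s with
    | leaf e =>
      intro x y m t h ha
      simp only [Branch.graph, sup_adj, edge_adj] at ha
      rcases ha with ha | ha
      · exact ⟨_, _, _, _, _, h.leaf_swap.flip, Or.inl (by simp; grind)⟩
      · exact ⟨_, _, _, _, _, h.leaf_swap, Or.inl (by simp; grind)⟩
    | node b z n s ih =>
      have key : ∀ (x y m : V) (t : Branch V), IsCaterpillar G x y m (.node true z n s) t →
          ((Branch.node true z n s).graph x y).Adj u v → ∃ x y m s t, IsCaterpillar G x y m s t ∧
          (s(u, v) = s(y, m) ∨ ∃ z n s', s = .node true z n s' ∧ s(u, v) = s(x, z)) := by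
        intro x y m t h ha
        simp only [Branch.graph, sup_adj, edge_adj] at ha
        rcases ha with ((ha | ha) | ha) | ha
        · exact ⟨_, _, _, _, _, h, Or.inr ⟨z, n, s, rfl, by simp; grind⟩⟩
        · exact ⟨_, _, _, _, _, h.reroot.flip, Or.inl (by simp; grind)⟩
        · exact ⟨_, _, _, _, _, h.reroot, Or.inl (by simp; grind)⟩
        · exact ih _ _ _ _ h.reroot ha
      intro x y m t h ha
      cases b
      · exact key _ _ _ _ h.flip ha
      · exact key _ _ _ _ h ha
  have huv' := huv
  rw [h.eq] at huv'
  simp only [caterpillar, sup_adj, edge_adj] at huv'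
  rcases huv' with ((ha | ha) | ha) | ha
  · exact ⟨_, _, _, _, _, h.flip, Or.inl (by simp; grind)⟩
  · exact ⟨_, _, _, _, _, h, Or.inl (by simp; grind)⟩
  · exact branch _ _ _ _ _ h ha
  · exact branch _ _ _ _ _ h.swap ha

end IsCaterpillar

/-! ### Double subdivisions as expressions in single edges -/

theorem doubleSubdivision_adj_inl_inl {G : SimpleGraph V} {u v a b : V} :
    (G.doubleSubdivision u v).Adj (Sum.inl a) (Sum.inl b) ↔ G.Adj a b ∧ s(a, b) ≠ s(u, v) := by
  simp [doubleSubdivision, deleteEdges_adj]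

theorem doubleSubdivision_adj_inl_inr {G : SimpleGraph V} {u v a : V} {i : Fin 2} :
    (G.doubleSubdivision u v).Adj (Sum.inl a) (Sum.inr i) ↔ a = u ∨ a = v := by
  simp [doubleSubdivision]
  exact fun _ => by omega

theorem doubleSubdivision_adj_inr_inr {G : SimpleGraph V} {u v : V} {i j : Fin 2} :
    ¬ (G.doubleSubdivision u v).Adj (Sum.inr i) (Sum.inr j) := by
  simp [doubleSubdivision]

theorem doubleSubdivision_comm (G : SimpleGraph V) (u v : V) :
    G.doubleSubdivision u v = G.doubleSubdivision v u := by
  simp only [doubleSubdivision, Sym2.eq_swap (a := u), or_comm]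

/-- Inside an ambient type, a double subdivision becomes a lattice expression in `edge`, directly
comparable with the formula for a caterpillar. -/
theorem doubleSubdivision_map (G : SimpleGraph V) (u v : V) (f : V ⊕ Fin 2 ↪ W) :
    (G.doubleSubdivision u v).map f =
      (G.map (Function.Embedding.inl.trans f) \ edge (f (Sum.inl u)) (f (Sum.inl v))) ⊔
        (edge (f (Sum.inl u)) (f (Sum.inr 0)) ⊔ edge (f (Sum.inl v)) (f (Sum.inr 0)) ⊔
        edge (f (Sum.inl u)) (f (Sum.inr 1)) ⊔ edge (f (Sum.inl v)) (f (Sum.inr 1))) := by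
  ext a b
  constructor
  · rw [map_adj]
    rintro ⟨a | i, b | j, h, rfl, rfl⟩
    · rw [doubleSubdivision_adj_inl_inl] at h
      refine Or.inl ⟨(map_adj ..).2 ⟨a, b, h.1, rfl, rfl⟩, ?_⟩
      rw [edge_adj]
      simp only [f.injective.eq_iff, Sum.inl.injEq]
      have := h.2
      simp at this
      tauto
    · rw [doubleSubdivision_adj_inl_inr] at h
      refine Or.inr ?_
      fin_cases j <;> rcases h with rfl | rfl <;> simp [edge_adj]
    · rw [adj_comm, doubleSubdivision_adj_inl_inr] at h
      refine Or.inr ?_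
      fin_cases i <;> rcases h with rfl | rfl <;> simp [edge_adj]
    · exact absurd h doubleSubdivision_adj_inr_inr
  · rintro (⟨h, hn⟩ | h)
    · rw [map_adj] at h
      obtain ⟨a, b, h, rfl, rfl⟩ := h
      refine (map_adj ..).2 ⟨Sum.inl a, Sum.inl b, doubleSubdivision_adj_inl_inl.2 ⟨h, ?_⟩,
        rfl, rfl⟩
      have hne := h.ne
      rw [edge_adj] at hn
      simp only [Function.Embedding.trans_apply, Function.Embedding.inl_apply,
        f.injective.eq_iff, Sum.inl.injEq, ne_eq, hne, not_false_eq_true, and_true] at hn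
      simp only [ne_eq, Sym2.eq_iff]
      exact hn
    · have hu : ∀ i, ((G.doubleSubdivision u v).map f).Adj (f (Sum.inl u)) (f (Sum.inr i)) :=
        fun i => map_adj_apply.2 (doubleSubdivision_adj_inl_inr.2 (Or.inl rfl))
      have hv : ∀ i, ((G.doubleSubdivision u v).map f).Adj (f (Sum.inl v)) (f (Sum.inr i)) :=
        fun i => map_adj_apply.2 (doubleSubdivision_adj_inl_inr.2 (Or.inr rfl))
      have hu' := fun i => (hu i).symm
      have hv' := fun i => (hv i).symm
      simp only [sup_adj, edge_adj] at h
      rcases h with ((h | h) | h) | h <;> obtain ⟨⟨rfl, rfl⟩ | ⟨rfl, rfl⟩, -⟩ := h <;>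
        simp only [hu, hv, hu', hv']

/-- Replacing an end leaf `e` of a caterpillar by a node realises a double subdivision. -/
theorem caterpillar_extend {x y m e a b : V} {t : Branch V}
    (h : (caterpillarVerts x y m (.leaf e) t).Nodup) :
    (caterpillar x y m (.leaf e) t \ edge y e) ⊔
      (edge y a ⊔ edge e a ⊔ edge y b ⊔ edge e b) =
    caterpillar x y m (.node true e a (.leaf b)) t := by
  -- As the listed vertices are distinct, no other term of the supremum contains the edge `ye`, so
  -- the difference removes exactly one term.
  have hR : ∀ c d, (edge y e).Adj c d → ¬ (edge m x ⊔ edge m y ⊔ edge x e ⊔ t.graph y x).Adj c d := by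
    intro c d hcd hR
    simp only [caterpillarVerts, Branch.verts, List.nodup_cons, List.mem_cons, List.mem_append] at h
    simp only [sup_adj, edge_adj] at hcd hR
    rcases hR with hR | hR
    · grind
    · have := Branch.mem_of_adj hR
      grind
  have h1 : caterpillar x y m (.leaf e) t =
      (edge m x ⊔ edge m y ⊔ edge x e ⊔ t.graph y x) ⊔ edge y e := by
    simp only [caterpillar, Branch.graph]; ac_rfl
  have h2 : caterpillar x y m (.leaf e) t \ edge y e =
      edge m x ⊔ edge m y ⊔ edge x e ⊔ t.graph y x := by
    rw [h1]
    ext c d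
    have := hR c d
    rw [sdiff_adj, sup_adj]
    exact ⟨fun h => h.1.resolve_right h.2, fun h => ⟨Or.inl h, fun h' => this h' h⟩⟩
  rw [h2]
  simp only [caterpillar, Branch.graph, edge_comm e a]; ac_rfl

/-! ### Pairs leaving three components, and the two conditions on 2-cuts -/

/-- The labelling `c` exhibits `{x, y}` as a pair of non-adjacent vertices whose removal leaves
exactly three components, each of them joined to both `x` and `y`. -/
structure IsThreeSplit (G : SimpleGraph V) (x y : V) (c : V → Option (Fin 3)) : Prop where
  ne : x ≠ y
  not_adj : ¬ G.Adj x y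
  eq_none : ∀ v, c v = none ↔ v = x ∨ v = y
  eq_of_adj : ∀ a b i j, G.Adj a b → c a = some i → c b = some j → i = j
  connected : ∀ i (T : Set V),
    (∀ a ∈ T, c a = some i → ∀ b, c b = some i → G.Adj a b → b ∈ T) →
    ∀ w ∈ T, c w = some i → ∀ v, c v = some i → v ∈ T
  left : ∀ i, ∃ v, c v = some i ∧ G.Adj x v
  right : ∀ i, ∃ v, c v = some i ∧ G.Adj y v

/-- Every pair of vertices that splits the graph into three components has both properties
`P₁` and `P₂`. -/
def HasThinSplits (G : SimpleGraph V) : Prop :=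
  ∀ x y c, G.IsThreeSplit x y c →
    (∀ i, {w | c w = some i ∧ G.Adj x w}.Subsingleton ∨
      {w | c w = some i ∧ G.Adj y w}.Subsingleton) ∧
    ∃ i, {w | c w = some i}.Subsingleton

namespace IsThreeSplit

variable {G : SimpleGraph V} {x y : V} {c : V → Option (Fin 3)}

theorem label_left (h : G.IsThreeSplit x y c) : c x = none := (h.eq_none x).2 (Or.inl rfl)

theorem label_right (h : G.IsThreeSplit x y c) : c y = none := (h.eq_none y).2 (Or.inr rfl)

theorem mem_compl (h : G.IsThreeSplit x y c) {w : V} {i : Fin 3} (hw : c w = some i) :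
    w ∈ ({x, y}ᶜ : Set V) := by
  intro hxy
  rw [(h.eq_none w).2 hxy] at hw
  cases hw

/-- Labels are constant along walks avoiding `x` and `y`, so a component lies in one class; the
closure property `connected` gives the converse. -/
theorem verts_component (h : G.IsThreeSplit x y c) {w : V} {i : Fin 3} (hw : c w = some i)
    (hw' : w ∈ ({x, y}ᶜ : Set V)) :
    CutComponent.verts (x := x) (y := y) ((G.induce ({x, y}ᶜ : Set V)).connectedComponentMk ⟨w, hw'⟩) =
      {v | c v = some i} := by
  ext v
  constructor
  · rintro ⟨⟨v, hv⟩, hvC, rfl⟩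
    have hr : (G.induce ({x, y}ᶜ : Set V)).Reachable ⟨v, hv⟩ ⟨w, hw'⟩ := ConnectedComponent.exact hvC
    obtain ⟨p⟩ := hr
    have : ∀ (a b : ({x, y}ᶜ : Set V)), (G.induce ({x, y}ᶜ : Set V)).Walk a b →
        c b = some i → c a = some i := by
      intro a b p hb
      induction p with
      | nil => exact hb
      | @cons a b d hab p ih =>
        have hb := ih hb
        rcases ha : c a with _ | j
        · exact absurd ((h.eq_none _).1 ha) a.2
        · rw [h.eq_of_adj _ _ _ _ hab ha hb]
    exact this _ _ p hw
  · intro hv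
    refine h.connected i (CutComponent.verts (x := x) (y := y)
      ((G.induce ({x, y}ᶜ : Set V)).connectedComponentMk ⟨w, hw'⟩)) ?_ w ⟨⟨w, hw'⟩, rfl, rfl⟩ hw v hv
    rintro _ ⟨a, ha, rfl⟩ - b hb hab
    refine ⟨⟨b, h.mem_compl hb⟩, ?_, rfl⟩
    have : (G.induce ({x, y}ᶜ : Set V)).Adj ⟨b, h.mem_compl hb⟩ a := hab.symm
    exact (ConnectedComponent.sound this.reachable).trans ha

theorem exists_component (h : G.IsThreeSplit x y c) (i : Fin 3) :
    ∃ C : G.CutComponent x y, CutComponent.verts C = {v | c v = some i} := by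
  obtain ⟨w, hw, -⟩ := h.left i
  exact ⟨_, h.verts_component hw (h.mem_compl hw)⟩

theorem exists_label (h : G.IsThreeSplit x y c) (C : G.CutComponent x y) :
    ∃ i : Fin 3, CutComponent.verts C = {v | c v = some i} := by
  induction C using ConnectedComponent.ind with
  | h w =>
    rcases w with ⟨w, hw⟩
    rcases hc : c w with _ | i
    · exact absurd ((h.eq_none _).1 hc) hw
    · exact ⟨i, h.verts_component hc hw⟩

theorem preconnected (h : G.IsThreeSplit x y c) : G.Preconnected := by
  have hx : ∀ v i, c v = some i → G.Reachable x v := by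
    intro v i hv
    obtain ⟨w, hw, hxw⟩ := h.left i
    exact h.connected i {v | G.Reachable x v}
      (fun a ha _ b _ hab => Reachable.trans ha hab.reachable) w hxw.reachable hw v hv
  have hx' : ∀ v, G.Reachable x v := by
    intro v
    rcases hc : c v with _ | i
    · rcases (h.eq_none _).1 hc with rfl | rfl
      · rfl
      · obtain ⟨w, hw, hyw⟩ := h.right 0
        exact (hx w _ hw).trans hyw.reachable.symm
    · exact hx v i hc
  exact fun a b => (hx' a).symm.trans (hx' b)

theorem isTwoCut [Finite V] (h : G.IsThreeSplit x y c) : G.IsTwoCut x y := by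
  refine ⟨h.ne, ?_⟩
  have h1 : Nat.card G.ConnectedComponent ≤ 1 := by
    rw [Finite.card_le_one_iff_subsingleton]
    exact h.preconnected.subsingleton_connectedComponent
  have h2 : 1 < Nat.card (G.induce ({x, y}ᶜ : Set V)).ConnectedComponent := by
    rw [Finite.one_lt_card_iff_nontrivial]
    obtain ⟨C, hC⟩ := h.exists_component 0
    obtain ⟨D, hD⟩ := h.exists_component 1
    refine ⟨C, D, ?_⟩
    rintro rfl
    obtain ⟨w, hw, -⟩ := h.left 0
    have : w ∈ {v | c v = some 1} := by rw [← hD, hC]; exact hw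
    rw [Set.mem_ofPred_eq, hw] at this
    simp at this
  exact lt_of_le_of_lt h1 h2

/-- The new vertices inherit the label of `u`. Since `v` is either in the same class or in `{x, y}`,
the path through a new vertex replaces the lost edge and no two classes get joined. -/
theorem lift_aux (h : G.IsThreeSplit x y c) {u v : V} (huv : G.Adj u v) {i : Fin 3}
    (hu : c u = some i) :
    (G.doubleSubdivision u v).IsThreeSplit (Sum.inl x) (Sum.inl y)
      (Sum.elim c (fun _ => some i)) := by
  have hv : c v = none ∨ c v = some i := by
    rcases hv : c v with _ | j
    · exact Or.inl rfl
    · exact Or.inr (by rw [h.eq_of_adj _ _ _ _ huv hu hv])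
  have attach : ∀ x, c x = none → ∀ j, (∃ v, c v = some j ∧ G.Adj x v) →
      ∃ w, Sum.elim c (fun _ => some i) w = some j ∧
        (G.doubleSubdivision u v).Adj (Sum.inl x) w := by
    rintro x hx j ⟨w, hw, hxw⟩
    by_cases he : s(x, w) = s(u, v)
    · rcases Sym2.eq_iff.1 he with ⟨rfl, rfl⟩ | ⟨rfl, rfl⟩
      · rw [hu] at hx; cases hx
      · exact ⟨Sum.inr 0, hu.symm.trans hw, doubleSubdivision_adj_inl_inr.2 (Or.inr rfl)⟩
    · exact ⟨Sum.inl w, hw, doubleSubdivision_adj_inl_inl.2 ⟨hxw, he⟩⟩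
  refine ⟨fun hxy => h.ne (Sum.inl_injective hxy),
    fun hxy => h.not_adj (doubleSubdivision_adj_inl_inl.1 hxy).1, ?_, ?_, ?_,
    fun j => attach x h.label_left j (h.left j), fun j => attach y h.label_right j (h.right j)⟩
  · rintro (w | k) <;> simp [h.eq_none]
  · have key : ∀ a k j, (G.doubleSubdivision u v).Adj (Sum.inl a) (Sum.inr k) → c a = some j →
        j = i := by
      intro a k j hab ha
      rcases doubleSubdivision_adj_inl_inr.1 hab with rfl | rfl <;> grind
    rintro (a | a) (b | b) j k hab ha hb
    · exact h.eq_of_adj _ _ _ _ (doubleSubdivision_adj_inl_inl.1 hab).1 ha hb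
    · exact (key _ _ _ hab ha).trans (Option.some_injective _ hb)
    · exact ((key _ _ _ hab.symm hb).trans (Option.some_injective _ ha)).symm
    · exact absurd hab doubleSubdivision_adj_inr_inr
  · intro j T hT
    have hinl : ∀ w, Sum.inl w ∈ T → c w = some j → ∀ v, c v = some j → Sum.inl v ∈ T := by
      refine h.connected j (Sum.inl ⁻¹' T) ?_
      intro a ha hca b hcb hab
      by_cases he : s(a, b) = s(u, v)
      · have hij : j = i := by rcases Sym2.eq_iff.1 he with ⟨rfl, rfl⟩ | ⟨rfl, rfl⟩ <;> grind
        have h0 : Sum.inr 0 ∈ T := hT _ ha hca _ (by simp [hij])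
          (doubleSubdivision_adj_inl_inr.2 (by grind))
        exact hT _ h0 (by simp [hij]) _ hcb (doubleSubdivision_adj_inl_inr.2 (by grind)).symm
      · exact hT _ ha hca _ hcb (doubleSubdivision_adj_inl_inl.2 ⟨hab, he⟩)
    have hall : ∀ w, Sum.inl w ∈ T → c w = some j →
        ∀ v, Sum.elim c (fun _ => some i) v = some j → v ∈ T := by
      rintro w hw hcw (v | k) hv
      · exact hinl w hw hcw v hv
      · have hij : i = j := Option.some_injective _ hv
        exact hT _ (hinl w hw hcw u (hij ▸ hu)) (hij ▸ hu) _ hv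
          (doubleSubdivision_adj_inl_inr.2 (Or.inl rfl))
    rintro (w | k) hw hcw
    · exact hall w hw hcw
    · have hij : i = j := Option.some_injective _ hcw
      exact hall u (hT _ hw hcw _ (hij ▸ hu)
        (doubleSubdivision_adj_inl_inr.2 (Or.inl rfl)).symm) (hij ▸ hu)

/-- As `x` and `y` are not adjacent, at least one end of the edge carries a label. -/
theorem exists_lift (h : G.IsThreeSplit x y c) {u v : V} (huv : G.Adj u v) :
    ∃ i, (c u = some i ∨ c v = some i) ∧
      (G.doubleSubdivision u v).IsThreeSplit (Sum.inl x) (Sum.inl y)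
        (Sum.elim c (fun _ => some i)) := by
  rcases hu : c u with _ | i
  · rcases hv : c v with _ | i
    · have hne := huv.ne
      have hna := h.not_adj
      have hna' := fun h' => h.not_adj (G.adj_symm h')
      rcases (h.eq_none _).1 hu with rfl | rfl <;> rcases (h.eq_none _).1 hv with rfl | rfl <;>
        contradiction
    · exact ⟨i, Or.inr rfl, doubleSubdivision_comm G v u ▸ h.lift_aux huv.symm hv⟩
  · exact ⟨i, Or.inl rfl, h.lift_aux huv hu⟩

theorem map {G' : SimpleGraph W} (h : G.IsThreeSplit x y c) (f : G ≃g G') :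
    G'.IsThreeSplit (f x) (f y) (c ∘ f.symm) := by
  refine ⟨f.injective.ne h.ne, fun h' => h.not_adj (f.map_adj_iff.1 h'), fun v => ?_,
    fun a b i j hab => h.eq_of_adj _ _ i j (f.symm.map_adj_iff.2 hab), ?_, ?_, ?_⟩
  · simp only [Function.comp, h.eq_none]
    rw [← f.injective.eq_iff, ← f.injective.eq_iff, f.apply_symm_apply]
  · intro i T hT w hw hcw v hv
    have := h.connected i (f ⁻¹' T) (fun a ha hca b hcb hab => hT _ ha (by simpa using hca) _
      (by simpa using hcb) (f.map_adj_iff.2 hab)) (f.symm w) (by simpa using hw) hcw _ hv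
    simpa using this
  all_goals
    intro i
  · obtain ⟨v, hv, hxv⟩ := h.left i
    exact ⟨f v, by simpa using hv, f.map_adj_iff.2 hxv⟩
  · obtain ⟨v, hv, hxv⟩ := h.right i
    exact ⟨f v, by simpa using hv, f.map_adj_iff.2 hxv⟩

end IsThreeSplit

theorem hasThinSplits_of_memK [Finite V] {G : SimpleGraph V} (h₁ : G.MemK₁) (h₂ : G.MemK₂) :
    G.HasThinSplits := by
  intro x y c h
  refine ⟨fun i => ?_, ?_⟩
  · obtain ⟨C, hC⟩ := h.exists_component i
    have hn : ∀ z, (CutComponent.bridge C).neighborSet z =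
        {w | (z ∈ CutComponent.verts C ∪ {x, y}) ∧ (w ∈ CutComponent.verts C ∪ {x, y}) ∧ G.Adj z w} := by
      intro z; ext w; simp [CutComponent.bridge]
    have hs : ∀ z, z = x ∨ z = y → ((CutComponent.bridge C).neighborSet z).ncard = 1 →
        {w | c w = some i ∧ G.Adj z w}.Subsingleton := by
      intro z hz h1
      obtain ⟨a, ha⟩ := Set.ncard_eq_one.1 h1
      refine (Set.subsingleton_singleton (a := a)).anti ?_
      rw [← ha, hn]
      rintro w ⟨hw, hzw⟩
      exact ⟨Or.inr (by simpa using hz), Or.inl (by rw [hC]; exact hw), hzw⟩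
    rcases h₁.2 x y h.isTwoCut C with h1 | h1
    · exact Or.inl (hs x (Or.inl rfl) h1)
    · exact Or.inr (hs y (Or.inr rfl) h1)
  · obtain ⟨C, h3⟩ := h₂.2 x y h.isTwoCut
    obtain ⟨i, hi⟩ := h.exists_label C
    refine ⟨i, ?_⟩
    have hv : (CutComponent.bridge C).verts = {w | c w = some i} ∪ {x, y} := by
      rw [← hi]; rfl
    have hd : Disjoint {w | c w = some i} ({x, y} : Set V) :=
      Set.disjoint_left.2 fun w hw => h.mem_compl hw
    rw [hv, Set.ncard_union_eq hd, Set.ncard_pair h.ne] at h3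
    obtain ⟨a, ha⟩ := Set.ncard_eq_one.1 (by omega : {w | c w = some i}.ncard = 1)
    rw [ha]
    exact Set.subsingleton_singleton

theorem HasThinSplits.of_iso {G : SimpleGraph V} {G' : SimpleGraph W} (h : G'.HasThinSplits)
    (f : G ≃g G') : G.HasThinSplits := by
  intro x y c hc
  obtain ⟨h1, i, h2⟩ := h _ _ _ (hc.map f)
  have key : ∀ z i, {w | (c ∘ f.symm) w = some i ∧ G'.Adj (f z) w}.Subsingleton →
      {w | c w = some i ∧ G.Adj z w}.Subsingleton := by
    intro z i hs a ha b hb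
    exact f.injective (hs ⟨by simpa using ha.1, f.map_adj_iff.2 ha.2⟩
      ⟨by simpa using hb.1, f.map_adj_iff.2 hb.2⟩)
  refine ⟨fun i => (h1 i).imp (key _ _) (key _ _), i, fun a ha b hb => ?_⟩
  exact f.injective (h2 (x := f a) (by simpa using ha) (y := f b) (by simpa using hb))

/-- Lift the split: classes can only grow, so a class that is a singleton above was one below. The
degree bound also descends, by the observation `hne`. -/
theorem HasThinSplits.of_doubleSubdivision {G : SimpleGraph V} {u v : V} (huv : G.Adj u v)
    (h : (G.doubleSubdivision u v).HasThinSplits) : G.HasThinSplits := by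
  intro x y c hc
  obtain ⟨i, hi, hc'⟩ := hc.exists_lift huv
  obtain ⟨h1, j, h2⟩ := h _ _ _ hc'
  have key : ∀ z j, c z = none →
      {w | Sum.elim c (fun _ => some i) w = some j ∧
        (G.doubleSubdivision u v).Adj (Sum.inl z) w}.Subsingleton →
      {w | c w = some j ∧ G.Adj z w}.Subsingleton := by
    intro z j hz hs
    -- If the subdivided edge joined `z` to its class, both new vertices would be neighbours of `z`
    -- in that class, against the bound.
    have hne : ∀ w, c w = some j → s(z, w) ≠ s(u, v) := by
      intro w hw he
      have hij : i = j := by grind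
      have := hs (x := Sum.inr 0) ⟨by simp [hij], doubleSubdivision_adj_inl_inr.2 (by grind)⟩
        (y := Sum.inr 1) ⟨by simp [hij], doubleSubdivision_adj_inl_inr.2 (by grind)⟩
      simp at this
    rintro a ⟨ha, hza⟩ b ⟨hb, hzb⟩
    exact Sum.inl_injective (hs (x := Sum.inl a)
      ⟨ha, doubleSubdivision_adj_inl_inl.2 ⟨hza, hne a ha⟩⟩ (y := Sum.inl b)
      ⟨hb, doubleSubdivision_adj_inl_inl.2 ⟨hzb, hne b hb⟩⟩)
  exact ⟨fun j => (h1 j).imp (key _ _ hc.label_left) (key _ _ hc.label_right), j,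
    fun a ha b hb => Sum.inl_injective (h2 ha hb)⟩

/-! ### The root pair of a caterpillar leaves three components -/

open Classical in
/-- The labelling of the vertices of a caterpillar at its root pair. -/
noncomputable def caterpillarLabel (x y m : V) (s : Branch V) (v : V) : Option (Fin 3) :=
  if v = x ∨ v = y then none else if v = m then some 0 else if v ∈ s.verts then some 1 else some 2

namespace IsCaterpillar

variable {G : SimpleGraph V} {x y m : V} {s t : Branch V}

theorem label_eq_none (v : V) : caterpillarLabel x y m s v = none ↔ v = x ∨ v = y := by
  unfold caterpillarLabel; split_ifs <;> simp_all

theorem label_eq_zero (h : IsCaterpillar G x y m s t) (v : V) :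
    caterpillarLabel x y m s v = some 0 ↔ v = m := by
  have := h.nodup
  simp only [caterpillarVerts, List.nodup_cons, List.mem_cons] at this
  unfold caterpillarLabel; split_ifs <;> simp_all; grind

theorem label_eq_one (h : IsCaterpillar G x y m s t) (v : V) :
    caterpillarLabel x y m s v = some 1 ↔ v ∈ s.verts := by
  have := h.nodup
  simp only [caterpillarVerts, List.nodup_cons, List.mem_cons, List.mem_append] at this
  unfold caterpillarLabel; split_ifs <;> simp_all; grind

theorem label_eq_two (h : IsCaterpillar G x y m s t) (v : V) :
    caterpillarLabel x y m s v = some 2 ↔ v ∈ t.verts := by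
  have h1 := h.nodup
  have h2 := h.mem v
  simp only [caterpillarVerts, List.nodup_cons, List.mem_cons, List.mem_append,
    List.nodup_append] at h1 h2
  unfold caterpillarLabel; split_ifs <;> simp <;> grind

/-- The classes 0, 1 and 2 are `{m}`, the branch `s` and the branch `t`. -/
theorem isThreeSplit (h : IsCaterpillar G x y m s t) :
    G.IsThreeSplit x y (caterpillarLabel x y m s) := by
  have hn := h.nodup
  simp only [caterpillarVerts, List.nodup_cons, List.mem_cons, List.mem_append,
    List.nodup_append] at hn
  have hxs : x ∉ s.verts := by grind
  have hys : y ∉ s.verts := by grind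
  have hxt : x ∉ t.verts := by grind
  have hyt : y ∉ t.verts := by grind
  have hsn : s.verts.Nodup := by grind
  have htn : t.verts.Nodup := by grind
  have hst : ∀ v ∈ s.verts, v ∉ t.verts := by grind
  have hms : m ∉ s.verts := by grind
  have hmt : m ∉ t.verts := by grind
  have adj : ∀ a b, G.Adj a b ↔ (edge m x).Adj a b ∨ (edge m y).Adj a b ∨ (s.graph x y).Adj a b ∨
      (t.graph y x).Adj a b := by
    intro a b; rw [h.eq]; simp only [caterpillar, sup_adj, or_assoc]
  have h3 : ∀ i : Fin 3, i = 0 ∨ i = 1 ∨ i = 2 := by decide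
  refine ⟨by grind, ?_, label_eq_none, ?_, ?_, ?_, ?_⟩
  · rw [adj]
    rintro (ha | ha | ha | ha)
    · rw [edge_adj] at ha; grind
    · rw [edge_adj] at ha; grind
    · have := Branch.mem_of_adj ha; grind
    · have := Branch.mem_of_adj ha; grind
  · intro a b i j hab ha hb
    rw [adj] at hab
    have hna : ¬ (a = x ∨ a = y) := by rw [← label_eq_none (m := m) (s := s), ha]; simp
    have hnb : ¬ (b = x ∨ b = y) := by rw [← label_eq_none (m := m) (s := s), hb]; simp
    rcases hab with hab | hab | hab | hab
    · rw [edge_adj] at hab; grind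
    · rw [edge_adj] at hab; grind
    · have := Branch.mem_of_adj hab
      have h1 := (h.label_eq_one a).2 (by grind)
      have h2 := (h.label_eq_one b).2 (by grind)
      rw [ha] at h1; rw [hb] at h2
      exact Option.some_injective _ (h1.trans h2.symm)
    · have := Branch.mem_of_adj hab
      have h1 := (h.label_eq_two a).2 (by grind)
      have h2 := (h.label_eq_two b).2 (by grind)
      rw [ha] at h1; rw [hb] at h2
      exact Option.some_injective _ (h1.trans h2.symm)
  · intro i T hT w hw hcw v hcv
    rcases h3 i with rfl | rfl | rfl
    · rw [h.label_eq_zero] at hcw hcv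
      rwa [hcv, ← hcw]
    · simp only [h.label_eq_one] at hT hcw hcv
      exact (Branch.verts_subset_of_closed hxs hys hsn (T := T ∩ {v | v ∈ s.verts})
        (fun a ha b hb hab => ⟨hT a ha.1 ha.2 b hb ((adj _ _).2 (Or.inr (Or.inr (Or.inl hab)))), hb⟩)
        hcw ⟨hw, hcw⟩ v hcv).1
    · simp only [h.label_eq_two] at hT hcw hcv
      exact (Branch.verts_subset_of_closed hyt hxt htn (T := T ∩ {v | v ∈ t.verts})
        (fun a ha b hb hab => ⟨hT a ha.1 ha.2 b hb ((adj _ _).2 (Or.inr (Or.inr (Or.inr hab)))), hb⟩)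
        hcw ⟨hw, hcw⟩ v hcv).1
  · intro i
    rcases h3 i with rfl | rfl | rfl
    · exact ⟨m, (h.label_eq_zero m).2 rfl, (adj _ _).2 (Or.inl (by rw [edge_adj]; grind))⟩
    · obtain ⟨v, hv, ha⟩ := (Branch.exists_adj hxs hys hsn).1
      exact ⟨v, (h.label_eq_one v).2 hv, (adj _ _).2 (by tauto)⟩
    · obtain ⟨v, hv, ha⟩ := (Branch.exists_adj hyt hxt htn).2
      exact ⟨v, (h.label_eq_two v).2 hv, (adj _ _).2 (by tauto)⟩
  · intro i
    rcases h3 i with rfl | rfl | rfl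
    · exact ⟨m, (h.label_eq_zero m).2 rfl, (adj _ _).2 (Or.inr (Or.inl (by rw [edge_adj]; grind)))⟩
    · obtain ⟨v, hv, ha⟩ := (Branch.exists_adj hxs hys hsn).2
      exact ⟨v, (h.label_eq_one v).2 hv, (adj _ _).2 (by tauto)⟩
    · obtain ⟨v, hv, ha⟩ := (Branch.exists_adj hyt hxt htn).1
      exact ⟨v, (h.label_eq_two v).2 hv, (adj _ _).2 (by tauto)⟩

end IsCaterpillar

/-! ### The structure theorem: triangle or caterpillar -/

theorem doubleSubdivision_congr (G : SimpleGraph V) {u v a b : V} (h : s(u, v) = s(a, b)) :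
    G.doubleSubdivision u v = G.doubleSubdivision a b := by
  rcases Sym2.eq_iff.1 h with ⟨rfl, rfl⟩ | ⟨rfl, rfl⟩
  · rfl
  · exact doubleSubdivision_comm ..

theorem triangle_extend {x y m : V} (hxy : x ≠ y) (hxm : x ≠ m) (hym : y ≠ m) (a b : V) :
    ((edge x y ⊔ edge m x ⊔ edge m y) \ edge x y) ⊔
      (edge x a ⊔ edge y a ⊔ edge x b ⊔ edge y b) =
    caterpillar x y m (.leaf a) (.leaf b) := by
  have : (edge x y ⊔ edge m x ⊔ edge m y) \ edge x y = edge m x ⊔ edge m y := by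
    ext c d
    simp only [sdiff_adj, sup_adj, edge_adj]
    grind
  rw [this]
  simp only [caterpillar, Branch.graph]; ac_rfl

namespace IsCaterpillar

variable {G : SimpleGraph V} {x y m z n e : V} {s t : Branch V}

theorem extend (h : IsCaterpillar G x y m (.leaf e) t) :
    IsCaterpillar (G.doubleSubdivision y e) (Sum.inl x) (Sum.inl y) (Sum.inl m)
      (.node true (Sum.inl e) (Sum.inr 0) (.leaf (Sum.inr 1))) (t.map Sum.inl) := by
  have hn : (caterpillarVerts (Sum.inl x) (Sum.inl y) (Sum.inl m) (.leaf (Sum.inl e))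
      (t.map (Sum.inl : V → V ⊕ Fin 2))).Nodup := by
    have := h.nodup.map (Sum.inl_injective (β := Fin 2))
    simpa [caterpillarVerts, Branch.verts] using this
  refine ⟨?_, ?_, ?_⟩
  · rw [← caterpillar_extend hn]
    have h1 := doubleSubdivision_map G y e (Function.Embedding.refl _)
    have h2 := caterpillar_map (Function.Embedding.inl (α := V) (β := Fin 2)) x y m (.leaf e) t
    rw [← h.eq] at h2
    simp only [Function.Embedding.coe_refl, map_id, Function.Embedding.trans_refl, id_eq, h2] at h1
    exact h1
  · simp only [caterpillarVerts, Branch.verts, List.nodup_cons, List.mem_cons,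
      Branch.verts_map, List.cons_append, List.nil_append, List.mem_map] at hn ⊢
    grind
  · rintro (v | k)
    · have := h.mem v
      simp only [caterpillarVerts, Branch.verts, List.mem_cons,
        Branch.verts_map, List.cons_append, List.nil_append, List.mem_map] at this ⊢
      grind
    · simp only [caterpillarVerts, Branch.verts, List.mem_cons,
        Branch.verts_map, List.cons_append, List.nil_append, List.mem_map]
      fin_cases k <;> simp

/-- If an edge of a caterpillar is doubly subdivided and the result still satisfies both
degree conditions on 2-cuts, then the result is a caterpillar. -/
theorem doubleSubdivision (h : IsCaterpillar G x y m s t) {u v : V} (huv : G.Adj u v)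
    (hl : (G.doubleSubdivision u v).HasThinSplits) :
    ∃ x y m s t, IsCaterpillar (G.doubleSubdivision u v) x y m s t := by
  obtain ⟨x, y, m, s, t, h, he⟩ := h.exists_root huv
  have hn := h.nodup
  have hsp := h.isThreeSplit
  rcases he with he | ⟨z, n, s', rfl, he⟩
  · have hym : G.Adj y m := by
      rw [← mem_edgeSet, ← he]; exact huv
    rw [doubleSubdivision_congr G he] at hl ⊢
    rcases s with e | ⟨b, z, n, s⟩
    · exact ⟨_, _, _, _, _, h.leaf_swap.extend⟩
    rcases t with e | ⟨b', z', n', t⟩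
    · exact ⟨_, _, _, _, _, (IsCaterpillar.leaf_swap (h.swap.flip)).extend⟩
    -- All three classes now have two vertices: the two new ones join `m`, and each branch is a
    -- node. No bridge is trivial.
    exfalso
    obtain ⟨i, hi, hc⟩ := hsp.exists_lift hym
    have hm := (h.label_eq_zero m).2 rfl
    rw [hsp.label_right, hm] at hi
    obtain rfl : i = 0 := by simpa [eq_comm] using hi
    obtain ⟨-, j, hj⟩ := hl _ _ _ hc
    have h3 : ∀ i : Fin 3, i = 0 ∨ i = 1 ∨ i = 2 := by decide
    simp only [caterpillarVerts, Branch.verts, List.nodup_cons, List.mem_cons, List.mem_append,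
      List.nodup_append] at hn
    rcases h3 j with rfl | rfl | rfl
    · have := hj (x := Sum.inr 0) rfl (y := Sum.inr 1) rfl
      simp at this
    · have := hj (x := Sum.inl z) ((h.label_eq_one z).2 (by simp [Branch.verts]))
        (y := Sum.inl n) ((h.label_eq_one n).2 (by simp [Branch.verts]))
      have := Sum.inl_injective this
      grind
    · have := hj (x := Sum.inl z') ((h.label_eq_two z').2 (by simp [Branch.verts]))
        (y := Sum.inl n') ((h.label_eq_two n').2 (by simp [Branch.verts]))
      have := Sum.inl_injective this
      grind
  · exfalso
    have hxz : G.Adj x z := by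
      rw [← mem_edgeSet, ← he]; exact huv
    rw [doubleSubdivision_congr G he] at hl
    obtain ⟨i, hi, hc⟩ := hsp.exists_lift hxz
    have hz := (h.label_eq_one z).2 (by simp [Branch.verts])
    rw [hsp.label_left, hz] at hi
    obtain rfl : i = 1 := by simpa [eq_comm] using hi
    simp only [caterpillarVerts, Branch.verts, List.nodup_cons, List.mem_cons, List.mem_append,
      List.nodup_append] at hn
    -- In class 1, `x` is joined to both new vertices, while `y` is joined to `n` and to some vertex
    -- of `s'`: both degrees exceed one.
    rcases (hl _ _ _ hc).1 1 with h1 | h1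
    · have := h1 (x := Sum.inr 0) ⟨rfl, doubleSubdivision_adj_inl_inr.2 (Or.inl rfl)⟩
        (y := Sum.inr 1) ⟨rfl, doubleSubdivision_adj_inl_inr.2 (Or.inl rfl)⟩
      simp at this
    · obtain ⟨w, hw, hyw⟩ := (Branch.exists_adj (t := s') (p := y) (q := z) (by grind) (by grind)
        (by grind)).1
      have hyw' : G.Adj y w := by
        rw [h.eq]; simp only [caterpillar, Branch.graph, sup_adj, hyw, or_true, true_or]
      have hyn : G.Adj y n := by
        rw [h.eq]; simp only [caterpillar, Branch.graph, sup_adj, edge_adj]; grind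
      have := h1 (x := Sum.inl w) ⟨(h.label_eq_one w).2 (by simp [Branch.verts, hw]),
          doubleSubdivision_adj_inl_inl.2 ⟨hyw', by simp; grind⟩⟩
        (y := Sum.inl n) ⟨(h.label_eq_one n).2 (by simp [Branch.verts]),
          doubleSubdivision_adj_inl_inl.2 ⟨hyn, by simp; grind⟩⟩
      have := Sum.inl_injective this
      grind

end IsCaterpillar

theorem exists_isCaterpillar_of_triangle {G : SimpleGraph V} (e : G ≃g completeGraph (Fin 3))
    {u v : V} (huv : G.Adj u v) :
    ∃ x y m s t, IsCaterpillar (G.doubleSubdivision u v) x y m s t := by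
  have h3 : ∀ i j : Fin 3, i ≠ j → ∃ k, k ≠ i ∧ k ≠ j ∧ ∀ l, l = i ∨ l = j ∨ l = k := by decide
  obtain ⟨k, hk1, hk2, hk⟩ := h3 (e u) (e v) (e.injective.ne huv.ne)
  obtain ⟨w, rfl⟩ := e.surjective k
  have hwu : w ≠ u := fun h => hk1 (congrArg e h)
  have hwv : w ≠ v := fun h => hk2 (congrArg e h)
  have hall : ∀ l, l = u ∨ l = v ∨ l = w := by
    intro l
    rcases hk (e l) with h | h | h <;> simp [e.injective h]
  have hadj : ∀ a b, G.Adj a b ↔ a ≠ b := by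
    intro a b
    rw [← e.map_adj_iff]
    simp [e.injective.eq_iff]
  have hG : G = edge u v ⊔ edge w u ⊔ edge w v := by
    ext a b
    rw [hadj]
    simp only [sup_adj, edge_adj]
    have := hall a
    have := hall b
    grind
  refine ⟨Sum.inl u, Sum.inl v, Sum.inl w, .leaf (Sum.inr 0), .leaf (Sum.inr 1), ?_, ?_, ?_⟩
  · rw [← triangle_extend (by simpa using huv.ne) (by simpa using hwu.symm)
      (by simpa using hwv.symm)]
    have h1 := doubleSubdivision_map G u v (Function.Embedding.refl _)
    have h2 := congrArg (fun H => SimpleGraph.map (Function.Embedding.inl (α := V) (β := Fin 2)) H) hG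
    simp only [map_sup_embedding, map_edge_embedding] at h2
    simp only [Function.Embedding.coe_refl, map_id, Function.Embedding.trans_refl, id_eq, h2] at h1
    exact h1
  · simp [caterpillarVerts, Branch.verts, hwu.symm, hwv.symm, huv.ne]
  · rintro (a | k)
    · have := hall a
      simpa [caterpillarVerts, Branch.verts] using this
    · fin_cases k <;> simp [caterpillarVerts, Branch.verts]

theorem IsGeneralisedTriangle.exists_isCaterpillar {V : Type u} {G : SimpleGraph V}
    (hG : G.IsGeneralisedTriangle) (hl : G.HasThinSplits) :
    Nonempty (G ≃g completeGraph (Fin 3)) ∨ ∃ x y m s t, IsCaterpillar G x y m s t := by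
  induction hG with
  | triangle e => exact Or.inl ⟨e⟩
  | @step V W G H u v hG huv e ih =>
    right
    have hl' := hl.of_iso e.symm
    have : ∃ x y m s t, IsCaterpillar (G.doubleSubdivision u v) x y m s t := by
      rcases ih (hl'.of_doubleSubdivision huv) with ⟨⟨e'⟩⟩ | ⟨x, y, m, s, t, h⟩
      · exact exists_isCaterpillar_of_triangle e' huv
      · exact h.doubleSubdivision huv hl'
    obtain ⟨x, y, m, s, t, h⟩ := this
    exact ⟨_, _, _, _, _, h.map e.symm⟩

/-! ### Caterpillars are generalised triangles -/

theorem IsGeneralisedTriangle.of_iso {G : SimpleGraph V} {H : SimpleGraph W}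
    (hG : G.IsGeneralisedTriangle) (f : H ≃g G) : H.IsGeneralisedTriangle := by
  cases hG with
  | triangle e => exact .triangle (f.trans e)
  | step hG huv e => exact .step hG huv (f.trans e)

/-- The edges of `G` form a generalised triangle whose vertices are those in the list `L`. -/
def IsGeneralisedTriangleOn (G : SimpleGraph V) (L : List V) : Prop :=
  ∃ (V₀ : Type u) (G₀ : SimpleGraph V₀) (f : V₀ ↪ V), G₀.IsGeneralisedTriangle ∧
    G₀.map f = G ∧ ∀ v, v ∈ Set.range f ↔ v ∈ L

theorem IsGeneralisedTriangleOn.extend {G : SimpleGraph V} {L L' : List V}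
    (h : IsGeneralisedTriangleOn G L) {u v a b : V} (huv : G.Adj u v) (ha : a ∉ L) (hb : b ∉ L)
    (hab : a ≠ b) (hL : ∀ w, w ∈ L' ↔ w ∈ L ∨ w = a ∨ w = b) :
    IsGeneralisedTriangleOn
      ((G \ edge u v) ⊔ (edge u a ⊔ edge v a ⊔ edge u b ⊔ edge v b)) L' := by
  obtain ⟨V₀, G₀, f, hG, rfl, hr⟩ := h
  rw [map_adj] at huv
  obtain ⟨u, v, huv, rfl, rfl⟩ := huv
  have hfa : ∀ w, f w ≠ a := fun w hw => ha ((hr a).1 ⟨w, hw⟩)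
  have hfb : ∀ w, f w ≠ b := fun w hw => hb ((hr b).1 ⟨w, hw⟩)
  let g : V₀ ⊕ Fin 2 ↪ V := ⟨Sum.elim f ![a, b], by
    refine f.injective.sumElim ?_ ?_
    · intro i j
      fin_cases i <;> fin_cases j <;> simp [hab, hab.symm]
    · intro w i
      fin_cases i
      · exact hfa w
      · exact hfb w⟩
  refine ⟨V₀ ⊕ Fin 2, G₀.doubleSubdivision u v, g, .step hG huv Iso.refl,
    doubleSubdivision_map G₀ u v g, fun w => ?_⟩
  rw [hL, ← hr]
  constructor
  · rintro ⟨w | i, rfl⟩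
    · exact Or.inl ⟨w, rfl⟩
    · fin_cases i
      · exact Or.inr (Or.inl rfl)
      · exact Or.inr (Or.inr rfl)
  · rintro (⟨w, rfl⟩ | rfl | rfl)
    · exact ⟨Sum.inl w, rfl⟩
    · exact ⟨Sum.inr 0, rfl⟩
    · exact ⟨Sum.inr 1, rfl⟩

theorem isGeneralisedTriangleOn_triangle {x y m : V} (hxy : x ≠ y) (hxm : x ≠ m) (hym : y ≠ m) :
    IsGeneralisedTriangleOn (edge x y ⊔ edge m x ⊔ edge m y) [x, y, m] := by
  -- `ULift` places the abstract triangle in the universe of `V`.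
  let f : ULift.{u} (Fin 3) ↪ V := ⟨fun i => ![x, y, m] i.down, by
    rintro ⟨i⟩ ⟨j⟩
    fin_cases i <;> fin_cases j <;> simp [hxy, hxm, hym, hxy.symm, hxm.symm, hym.symm]⟩
  have h0 : f ⟨0⟩ = x := rfl
  have h1 : f ⟨1⟩ = y := rfl
  have h2 : f ⟨2⟩ = m := rfl
  refine ⟨_, completeGraph (ULift.{u} (Fin 3)), f, .triangle (Iso.completeGraph Equiv.ulift), ?_, ?_⟩
  · ext a b
    rw [map_adj]
    simp only [sup_adj, edge_adj]
    constructor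
    · rintro ⟨⟨i⟩, ⟨j⟩, h, rfl, rfl⟩
      fin_cases i <;> fin_cases j <;> simp [h0, h1, h2] at h ⊢ <;> grind
    · rintro ((h | h) | h) <;> obtain ⟨⟨rfl, rfl⟩ | ⟨rfl, rfl⟩, -⟩ := h
      · exact ⟨⟨0⟩, ⟨1⟩, by simp, rfl, rfl⟩
      · exact ⟨⟨1⟩, ⟨0⟩, by simp, rfl, rfl⟩
      · exact ⟨⟨2⟩, ⟨0⟩, by simp, rfl, rfl⟩
      · exact ⟨⟨0⟩, ⟨2⟩, by simp, rfl, rfl⟩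
      · exact ⟨⟨2⟩, ⟨1⟩, by simp, rfl, rfl⟩
      · exact ⟨⟨1⟩, ⟨2⟩, by simp, rfl, rfl⟩
  · intro v
    simp only [List.mem_cons, List.not_mem_nil, or_false]
    constructor
    · rintro ⟨⟨i⟩, rfl⟩
      fin_cases i <;> simp [h0, h1, h2]
    · rintro (rfl | rfl | rfl)
      · exact ⟨⟨0⟩, rfl⟩
      · exact ⟨⟨1⟩, rfl⟩
      · exact ⟨⟨2⟩, rfl⟩

theorem isGeneralisedTriangleOn_caterpillar (t : Branch V) (x y m e : V)
    (h : (caterpillarVerts x y m (.leaf e) t).Nodup) :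
    IsGeneralisedTriangleOn (caterpillar x y m (.leaf e) t)
      (caterpillarVerts x y m (.leaf e) t) := by
  induction t generalizing x y m e with
  | leaf e' =>
    simp only [caterpillarVerts, Branch.verts, List.nodup_cons, List.mem_cons, List.mem_append,
      List.not_mem_nil, or_false, List.nodup_append] at h
    rw [← triangle_extend (by grind) (by grind) (by grind)]
    refine (isGeneralisedTriangleOn_triangle (by grind) (by grind) (by grind)).extend ?_ ?_ ?_ ?_ ?_
    · simp only [sup_adj, edge_adj]; grind
    · simp only [List.mem_cons]; grind
    · simp only [List.mem_cons]; grind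
    · grind
    · simp only [caterpillarVerts, Branch.verts, List.mem_cons, List.mem_append]; grind
  | node b z n t ih =>
    have key : ∀ x y : V, (caterpillarVerts x y m (.leaf e) (.node true z n t)).Nodup →
        IsGeneralisedTriangleOn (caterpillar x y m (.leaf e) (.node true z n t))
          (caterpillarVerts x y m (.leaf e) (.node true z n t)) := by
      intro x y h
      simp only [caterpillarVerts, Branch.verts, List.nodup_cons, List.mem_cons, List.mem_append,
        List.not_mem_nil, or_false, List.nodup_append] at h
      have hn : (caterpillarVerts z x n (.leaf y) t).Nodup := by
        simp only [caterpillarVerts, Branch.verts, List.nodup_cons, List.mem_cons, List.mem_append,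
          List.not_mem_nil, or_false, List.nodup_append]
        grind
      -- Seen from `{z, x}`, the vertices `m` and `e` arise by doubly subdividing the edge `xy` of a
      -- shorter caterpillar in which `y` is the end leaf.
      rw [caterpillar_swap, caterpillar_reroot, caterpillar_swap, ← caterpillar_extend hn]
      refine (ih z x n y hn).extend ?_ ?_ ?_ ?_ ?_
      · simp only [caterpillar, Branch.graph, sup_adj, edge_adj]; grind
      · simp only [caterpillarVerts, Branch.verts, List.mem_cons, List.mem_append]; grind
      · simp only [caterpillarVerts, Branch.verts, List.mem_cons, List.mem_append]; grind
      · grind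
      · simp only [caterpillarVerts, Branch.verts, List.mem_cons, List.mem_append]; grind
    cases b
    · have hn : (caterpillarVerts y x m (.leaf e) (.node true z n t)).Nodup := by
        simp only [caterpillarVerts, Branch.verts, List.nodup_cons, List.mem_cons] at h ⊢
        grind
      obtain ⟨V₀, G₀, f, h1, h2, h3⟩ := key y x hn
      refine ⟨V₀, G₀, f, h1, h2.trans (caterpillar_flip ..), fun v => (h3 v).trans ?_⟩
      simp only [caterpillarVerts, Branch.verts, List.mem_cons]
      tauto
    · exact key x y h

theorem IsCaterpillar.isGeneralisedTriangle {G : SimpleGraph V} {x y m e : V} {t : Branch V}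
    (h : IsCaterpillar G x y m (.leaf e) t) : G.IsGeneralisedTriangle := by
  obtain ⟨V₀, G₀, f, hG, hf, hr⟩ := isGeneralisedTriangleOn_caterpillar t x y m e h.nodup
  rw [← h.eq] at hf
  subst hf
  let g : V₀ ≃ V := Equiv.ofBijective f ⟨f.injective, fun v => (hr v).2 (h.mem v)⟩
  exact hG.of_iso (Iso.map g G₀).symm

/-! ### Whitney switches on caterpillars -/

theorem Branch.graph_swap_adj {s : Branch V} {x y a b : V} (hx : x ∉ s.verts) (hy : y ∉ s.verts)
    [DecidableEq V] :
    (s.graph y x).Adj (Equiv.swap x y a) (Equiv.swap x y b) ↔ (s.graph x y).Adj a b := by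
  have h1 := Branch.graph_map (Equiv.swap x y).toEmbedding s x y
  simp only [Equiv.toEmbedding_apply, Equiv.swap_apply_left, Equiv.swap_apply_right] at h1
  rw [Branch.map_eq_self s (f := (Equiv.swap x y).toEmbedding)] at h1
  · rw [← h1]
    exact map_adj_apply (f := (Equiv.swap x y).toEmbedding)
  · intro v hv
    exact Equiv.swap_apply_of_ne_of_ne (by grind) (by grind)

theorem Branch.graph_swap_adj_iff {s : Branch V} {x y : V} (hx : x ∉ s.verts)
    (hy : y ∉ s.verts) (a b : V) : (s.graph y x).Adj a b ↔
      (a ∈ s.verts ∧ b ∈ s.verts ∧ (s.graph x y).Adj a b) ∨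
      (a ∈ s.verts ∧ b = x ∧ (s.graph x y).Adj a y) ∨
      (a ∈ s.verts ∧ b = y ∧ (s.graph x y).Adj a x) ∨
      (b ∈ s.verts ∧ a = x ∧ (s.graph x y).Adj b y) ∨
      (b ∈ s.verts ∧ a = y ∧ (s.graph x y).Adj b x) := by
  classical
  have hfix : ∀ a ∈ s.verts, Equiv.swap x y a = a := fun a ha =>
    Equiv.swap_apply_of_ne_of_ne (fun h => hx (h ▸ ha)) (fun h => hy (h ▸ ha))
  have hin : ∀ a ∈ s.verts, ∀ b ∈ s.verts, (s.graph y x).Adj a b ↔ (s.graph x y).Adj a b := by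
    intro a ha b hb
    rw [← Branch.graph_swap_adj hx hy, hfix a ha, hfix b hb]
  have hsx : ∀ a ∈ s.verts, (s.graph y x).Adj a x ↔ (s.graph x y).Adj a y := by
    intro a ha
    rw [← Branch.graph_swap_adj hx hy, hfix a ha, Equiv.swap_apply_right]
  have hsy : ∀ a ∈ s.verts, (s.graph y x).Adj a y ↔ (s.graph x y).Adj a x := by
    intro a ha
    rw [← Branch.graph_swap_adj hx hy, hfix a ha, Equiv.swap_apply_left]
  constructor
  · intro hab
    obtain ⟨h1, h2, h3⟩ := Branch.mem_of_adj hab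
    by_cases ha : a ∈ s.verts
    · rcases h3 with hb | rfl | rfl
      · exact Or.inl ⟨ha, hb, (hin a ha b hb).1 hab⟩
      · exact Or.inr (Or.inr (Or.inl ⟨ha, rfl, (hsy a ha).1 hab⟩))
      · exact Or.inr (Or.inl ⟨ha, rfl, (hsx a ha).1 hab⟩)
    · have hb := h1.resolve_left ha
      rcases h2.resolve_left ha with rfl | rfl
      · exact Or.inr (Or.inr (Or.inr (Or.inr ⟨hb, rfl, (hsy b hb).1 hab.symm⟩)))
      · exact Or.inr (Or.inr (Or.inr (Or.inl ⟨hb, rfl, (hsx b hb).1 hab.symm⟩)))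
  · rintro (⟨ha, hb, h⟩ | ⟨ha, hb, h⟩ | ⟨ha, hb, h⟩ | ⟨hb, ha, h⟩ | ⟨hb, ha, h⟩)
    · exact (hin a ha b hb).2 h
    · rw [hb]; exact (hsx a ha).2 h
    · rw [hb]; exact (hsy a ha).2 h
    · rw [ha]; exact ((hsx b hb).2 h).symm
    · rw [ha]; exact ((hsy b hb).2 h).symm

namespace IsCaterpillar

variable {G : SimpleGraph V} {x y m z n e : V} {s t : Branch V}

/-- The branch `s` is a component of the graph without its root pair, and exchanging its poles is
exactly the switch of that component. -/
theorem isWhitneySwitch [Finite V] (h : IsCaterpillar G x y m s t) :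
    IsWhitneySwitch G (caterpillar x y m s.flip t) := by
  classical
  obtain ⟨C, hC⟩ := h.isThreeSplit.exists_component 1
  refine ⟨x, y, h.isThreeSplit.isTwoCut, C, ?_⟩
  have hmem : ∀ v, v ∈ CutComponent.verts C ↔ v ∈ s.verts := by
    intro v; rw [hC]; exact h.label_eq_one v
  have hn := h.nodup
  simp only [caterpillarVerts, List.nodup_cons, List.mem_cons, List.mem_append,
    List.nodup_append] at hn
  have hx : x ∉ s.verts := by grind
  have hy : y ∉ s.verts := by grind
  have hxy : x ≠ y := by grind
  obtain ⟨A, hAdef⟩ : ∃ A : SimpleGraph V, A = edge m x ⊔ edge m y ⊔ t.graph y x := ⟨_, rfl⟩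
  have hA : ∀ a b, A.Adj a b → a ∉ s.verts ∧ b ∉ s.verts := by
    intro a b hab
    simp only [hAdef, sup_adj] at hab
    rcases hab with (hab | hab) | hab
    · rw [edge_adj] at hab; grind
    · rw [edge_adj] at hab; grind
    · have := Branch.mem_of_adj hab
      grind
  have hG : ∀ a b, G.Adj a b ↔ A.Adj a b ∨ (s.graph x y).Adj a b := by
    intro a b; rw [h.eq]; simp only [hAdef, caterpillar, sup_adj]; tauto
  have hH : ∀ a b, (caterpillar x y m s.flip t).Adj a b ↔ A.Adj a b ∨ (s.graph y x).Adj a b := by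
    intro a b; simp only [hAdef, caterpillar, sup_adj, Branch.graph_flip]; tauto
  ext a b
  rw [hH, Branch.graph_swap_adj_iff hx hy]
  simp only [CutComponent.switch, fromRel_adj, hmem, hG]
  have hA' := hA a b
  have hAne : A.Adj a b → a ≠ b := fun h => h.ne
  have hAs : A.Adj b a ↔ A.Adj a b := adj_comm ..
  have hBs : (s.graph x y).Adj b a ↔ (s.graph x y).Adj a b := adj_comm ..
  have hBne : (s.graph x y).Adj a b → a ≠ b := fun h => h.ne
  have hBm : (s.graph x y).Adj a b → _ := fun h => Branch.mem_of_adj h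
  have hAax := hA a x
  have hAay := hA a y
  have hAbx := hA b x
  have hAby := hA b y
  grind

theorem of_flip (h : IsCaterpillar G x y m s t) :
    IsCaterpillar (caterpillar x y m s.flip t) x y m s.flip t :=
  ⟨rfl, by simpa [caterpillarVerts] using h.nodup, by simpa [caterpillarVerts] using h.mem⟩

theorem exists_leaf (h : IsCaterpillar G x y m s t) :
    ∃ x y m e t, IsCaterpillar G x y m (.leaf e) t := by
  induction s generalizing x y m t with
  | leaf e => exact ⟨_, _, _, _, _, h⟩
  | node b z n s ih =>
    cases b
    · exact ih h.flip.reroot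
    · exact ih h.reroot

/-- Move the root along `s`, switching whenever the next Boolean is `false`. The switch leaves `t`
alone, and each rerooting prepends a `true` to it. -/
theorem exists_zigzag [Finite V] (h : IsCaterpillar G x y m s t) (ht : t.IsZigzag) :
    ∃ H x y m e t, Relation.ReflTransGen IsWhitneySwitch G H ∧
      IsCaterpillar H x y m (.leaf e) t ∧ t.IsZigzag := by
  induction s generalizing G x y m t with
  | leaf e => exact ⟨G, _, _, _, _, _, .refl, h, ht⟩
  | node b z n s ih =>
    cases b
    · obtain ⟨H, x', y', m', e, t', h1, h2⟩ := ih h.of_flip.reroot ⟨rfl, ht⟩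
      exact ⟨H, x', y', m', e, t', .head h.isWhitneySwitch h1, h2⟩
    · exact ih h.reroot ⟨rfl, ht⟩

end IsCaterpillar

/-! ### Hamiltonian paths -/

/-- The vertices of a zigzag branch in the order of a Hamiltonian path. -/
def Branch.path : Branch V → List V
  | .leaf e => [e]
  | .node _ z n t => n :: z :: t.path

theorem Branch.path_perm (t : Branch V) : t.path.Perm t.verts := by
  induction t with
  | leaf e => rfl
  | node b z n t ih => exact (List.Perm.swap z n _).trans ((ih.cons n).cons z)

/-- The path enters from the second pole `q` and runs `q`, `n`, `z`. For `true` the vertex `z` is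
the second pole of the remaining branch, so the pattern repeats. -/
theorem Branch.isChain_path {t : Branch V} (ht : t.IsZigzag) {p q : V} {G : SimpleGraph V}
    (hG : t.graph p q ≤ G) (hq : q ∉ t.verts) (hn : t.verts.Nodup) :
    (q :: t.path).IsChain G.Adj := by
  induction t generalizing p q with
  | leaf e =>
    simp only [path, List.isChain_cons_cons, List.isChain_singleton, and_true]
    simp only [verts, List.mem_singleton] at hq
    exact hG (by simp only [graph, sup_adj, edge_adj]; grind)
  | node b z n t ih =>
    obtain ⟨rfl, ht⟩ := ht
    simp only [verts, List.mem_cons, List.nodup_cons] at hq hn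
    simp only [path, List.isChain_cons_cons]
    refine ⟨hG ?_, hG ?_, ih ht (p := q) (le_trans ?_ hG) (by grind) (by grind)⟩
    · simp only [graph, sup_adj, edge_adj]; grind
    · simp only [graph, sup_adj, edge_adj]; grind
    · exact le_sup_right

theorem hasHamiltonianPath_of_list {G : SimpleGraph V} (L : List V) (hne : L ≠ [])
    (hL : L.IsChain G.Adj) (hn : L.Nodup) (hm : ∀ v, v ∈ L) : G.HasHamiltonianPath := by
  classical
  refine ⟨_, _, Walk.ofSupport L hne hL, fun v => ?_⟩
  rw [Walk.support_ofSupport]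
  convert List.count_eq_one_of_mem hn (hm v)

theorem IsCaterpillar.hasHamiltonianPath {G : SimpleGraph V} {x y m e : V} {t : Branch V}
    (h : IsCaterpillar G x y m (.leaf e) t) (ht : t.IsZigzag) : G.HasHamiltonianPath := by
  have hp : (e :: y :: m :: x :: t.path).Perm (caterpillarVerts x y m (.leaf e) t) := by
    classical
    simp only [caterpillarVerts, List.perm_iff_count, List.count_cons, List.count_append,
      Branch.verts, t.path_perm.count_eq, List.count_nil]
    intro a; omega
  refine hasHamiltonianPath_of_list (e :: y :: m :: x :: t.path) (by simp) ?_
    (hp.nodup_iff.2 h.nodup) fun v => hp.mem_iff.2 (h.mem v)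
  have hn := h.nodup
  simp only [caterpillarVerts, Branch.verts, List.nodup_cons, List.mem_cons, List.mem_append,
    List.not_mem_nil, or_false, List.nodup_append] at hn
  have hle : t.graph y x ≤ G := by rw [h.eq]; exact le_sup_right
  simp only [List.isChain_cons_cons]
  refine ⟨?_, ?_, ?_, Branch.isChain_path ht hle (by grind) (by grind)⟩ <;>
  · rw [h.eq]
    simp only [caterpillar, Branch.graph, sup_adj, edge_adj]
    grind

theorem hasHamiltonianPath_of_triangle {G : SimpleGraph V} (e : G ≃g completeGraph (Fin 3)) :
    G.HasHamiltonianPath := by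
  have hadj : ∀ i j : Fin 3, i ≠ j → G.Adj (e.symm i) (e.symm j) := fun i j h =>
    e.symm.map_adj_iff.2 h
  refine hasHamiltonianPath_of_list [e.symm 0, e.symm 1, e.symm 2] (by simp) ?_ ?_ ?_
  · simp [hadj]
  · simp [e.symm.injective.eq_iff]
  · intro v
    obtain ⟨i, rfl⟩ := e.symm.surjective v
    fin_cases i <;> simp

/-! ### Switches preserve the chromatic polynomial -/

section Switch

variable {G : SimpleGraph V} {x y : V} (C : G.CutComponent x y)

namespace CutComponent

theorem left_notMem_verts : x ∉ CutComponent.verts C := by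
  rintro ⟨v, -, hv⟩
  exact v.2 (Or.inl hv)

theorem right_notMem_verts : y ∉ CutComponent.verts C := by
  rintro ⟨v, -, hv⟩
  exact v.2 (Or.inr hv)

theorem mem_verts_or_of_adj {a b : V} (ha : a ∈ CutComponent.verts C) (hab : G.Adj a b) :
    b ∈ CutComponent.verts C ∨ b = x ∨ b = y := by
  obtain ⟨a, ha, rfl⟩ := ha
  by_cases hb : b ∈ ({x, y} : Set V)
  · exact Or.inr hb
  · left
    refine ⟨⟨b, hb⟩, ?_, rfl⟩
    have : (G.induce ({x, y}ᶜ : Set V)).Adj ⟨b, hb⟩ a := hab.symm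
    exact (ConnectedComponent.sound this.reachable).trans ha

open Classical in
/-- On the component `C`, exchange the colours of `x` and `y`. -/
noncomputable def recolor {n : ℕ} (c : V → Fin n) (v : V) : Fin n :=
  if v ∈ CutComponent.verts C then Equiv.swap (c x) (c y) (c v) else c v

theorem recolor_of_mem {n : ℕ} (c : V → Fin n) {v : V} (hv : v ∈ CutComponent.verts C) :
    recolor C c v = Equiv.swap (c x) (c y) (c v) := if_pos hv

theorem recolor_of_notMem {n : ℕ} (c : V → Fin n) {v : V} (hv : v ∉ CutComponent.verts C) :
    recolor C c v = c v := if_neg hv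

/-- The vertices `x` and `y` lie outside `C` and keep their colours, so the same transposition is
applied twice. -/
theorem recolor_recolor {n : ℕ} (c : V → Fin n) : recolor C (recolor C c) = c := by
  funext v
  by_cases hv : v ∈ CutComponent.verts C
  · rw [recolor_of_mem C _ hv, recolor_of_mem C _ hv, recolor_of_notMem C _ (left_notMem_verts C),
      recolor_of_notMem C _ (right_notMem_verts C), Equiv.swap_apply_self]
  · rw [recolor_of_notMem C _ hv, recolor_of_notMem C _ hv]

theorem recolor_eq_iff_left {n : ℕ} (c : V → Fin n) {v : V} (hv : v ∈ CutComponent.verts C) :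
    recolor C c v = recolor C c x ↔ c v = c y := by
  rw [recolor_of_mem C _ hv, recolor_of_notMem C _ (left_notMem_verts C),
    Equiv.swap_apply_eq_iff, Equiv.swap_apply_left]

theorem recolor_eq_iff_right {n : ℕ} (c : V → Fin n) {v : V} (hv : v ∈ CutComponent.verts C) :
    recolor C c v = recolor C c y ↔ c v = c x := by
  rw [recolor_of_mem C _ hv, recolor_of_notMem C _ (right_notMem_verts C),
    Equiv.swap_apply_eq_iff, Equiv.swap_apply_right]

theorem recolor_eq_iff {n : ℕ} (c : V → Fin n) {v w : V}
    (h : v ∈ CutComponent.verts C ↔ w ∈ CutComponent.verts C) :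
    recolor C c v = recolor C c w ↔ c v = c w := by
  by_cases hv : v ∈ CutComponent.verts C
  · rw [recolor_of_mem C _ hv, recolor_of_mem C _ (h.1 hv), (Equiv.swap _ _).injective.eq_iff]
  · rw [recolor_of_notMem C _ hv, recolor_of_notMem C _ (fun hw => hv (h.2 hw))]

/-- Recolouring a component is a bijection between the proper colourings of a graph and those
of its Whitney switch. -/
theorem valid_recolor_iff {n : ℕ} (c : V → Fin n) :
    (∀ a b, (CutComponent.switch C).Adj a b → recolor C c a ≠ recolor C c b) ↔
      ∀ a b, G.Adj a b → c a ≠ c b := by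
  have hx := left_notMem_verts C
  have hy := right_notMem_verts C
  constructor
  · intro h
    have out : ∀ a b, G.Adj a b → a ∈ CutComponent.verts C → b ∉ CutComponent.verts C →
        c a ≠ c b := by
      intro a b hab ha hb
      rcases mem_verts_or_of_adj C ha hab with hb' | rfl | rfl
      · exact absurd hb' hb
      · rw [ne_eq, ← recolor_eq_iff_right C c ha]
        exact h _ _ ((fromRel_adj ..).2 ⟨fun he => hy (he ▸ ha), by tauto⟩)
      · rw [ne_eq, ← recolor_eq_iff_left C c ha]
        exact h _ _ ((fromRel_adj ..).2 ⟨fun he => hx (he ▸ ha), by tauto⟩)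
    intro a b hab
    by_cases hs : a ∈ CutComponent.verts C ↔ b ∈ CutComponent.verts C
    · rw [ne_eq, ← recolor_eq_iff C c hs]
      exact h _ _ ((fromRel_adj ..).2 ⟨hab.ne, Or.inl (Or.inl ⟨hab, hs⟩)⟩)
    · by_cases ha : a ∈ CutComponent.verts C
      · exact out a b hab ha (by tauto)
      · exact (out b a hab.symm (by tauto) ha).symm
  · intro h
    have key : ∀ a b, ((G.Adj a b ∧ (a ∈ CutComponent.verts C ↔ b ∈ CutComponent.verts C)) ∨
        (a ∈ CutComponent.verts C ∧ b = x ∧ G.Adj a y) ∨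
        (a ∈ CutComponent.verts C ∧ b = y ∧ G.Adj a x)) → recolor C c a ≠ recolor C c b := by
      rintro a b (⟨hab, hs⟩ | ⟨ha, rfl, hab⟩ | ⟨ha, rfl, hab⟩)
      · rw [ne_eq, recolor_eq_iff C c hs]; exact h _ _ hab
      · rw [ne_eq, recolor_eq_iff_left C c ha]; exact h _ _ hab
      · rw [ne_eq, recolor_eq_iff_right C c ha]; exact h _ _ hab
    intro a b hab
    rcases ((fromRel_adj ..).1 hab).2 with hab | hab
    · exact key a b hab
    · exact (key b a hab).symm

theorem card_coloring_switch (n : ℕ) :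
    Nat.card (G.Coloring (Fin n)) = Nat.card ((CutComponent.switch C).Coloring (Fin n)) := by
  refine Nat.card_congr
    { toFun := fun c => Coloring.mk (recolor C c) fun {a b} hab =>
        (valid_recolor_iff C c).2 (fun a b h => c.valid h) a b hab
      invFun := fun c => Coloring.mk (recolor C c) fun {a b} hab =>
        (valid_recolor_iff C (recolor C c)).1
          (by rw [recolor_recolor]; exact fun a b h => c.valid h) a b hab
      left_inv := fun c => DFunLike.coe_injective (recolor_recolor C c)
      right_inv := fun c => DFunLike.coe_injective (recolor_recolor C c) }

end CutComponent

end Switch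

theorem chromaticPolynomial_congr [Finite V] {G H : SimpleGraph V}
    (h : ∀ n, Nat.card (G.Coloring (Fin n)) = Nat.card (H.Coloring (Fin n))) :
    G.chromaticPolynomial = H.chromaticPolynomial :=
  (existsUnique_chromaticPolynomial H).unique
    (fun n => by rw [chromaticPolynomial_eval, h]) (chromaticPolynomial_eval H)

theorem chromaticPolynomial_eq_of_switches [Finite V] {G H : SimpleGraph V}
    (h : Relation.ReflTransGen IsWhitneySwitch G H) :
    G.chromaticPolynomial = H.chromaticPolynomial := by
  induction h with
  | refl => rfl
  | tail _ hs ih =>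
    obtain ⟨x, y, -, C, rfl⟩ := hs
    exact ih.trans (chromaticPolynomial_congr (CutComponent.card_coloring_switch C))

end SimpleGraph

theorem lemma22 {V : Type*} [Finite V] (G : SimpleGraph V) (h₁ : G.MemK₁) (h₂ : G.MemK₂) :
    ∃ H : SimpleGraph V,
      Relation.ReflTransGen SimpleGraph.IsWhitneySwitch G H ∧
      H.IsGeneralisedTriangle ∧ H.HasHamiltonianPath ∧
      G.chromaticPolynomial = H.chromaticPolynomial := by
  rcases h₁.1.exists_isCaterpillar (SimpleGraph.hasThinSplits_of_memK h₁ h₂) with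
    ⟨⟨e⟩⟩ | ⟨x, y, m, s, t, h⟩
  · exact ⟨G, .refl, h₁.1, SimpleGraph.hasHamiltonianPath_of_triangle e, rfl⟩
  · obtain ⟨x, y, m, e, t, h⟩ := h.exists_leaf
    -- Starting from an end of the chain, the opposite branch is a leaf and hence trivially a
    -- zigzag.
    obtain ⟨H, x, y, m, e', t', hGH, hH, ht⟩ := h.swap.exists_zigzag (t := .leaf e) trivial
    exact ⟨H, hGH, hH.isGeneralisedTriangle, hH.hasHamiltonianPath ht,
      SimpleGraph.chromaticPolynomial_eq_of_switches hGH⟩
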